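/- Let $n\ge 2$, let $c_0,c_2,\dots,c_{n-1}$ be integers, and let $\varepsilon,\delta\in\{1,-1\}$. Put \[ f(x)=c_0+\varepsilon x+c_2\frac{x^2}{2!}+\dots+c_{n-1}\frac{x^{n-1}}{(n-1)!}+\delta\frac{x^n}{n!}\in\mathbb{Q}[x] \] (so $f(x)=c_0+\varepsilon x+\delta x^2/2$ if $n=2$). Then: (i) the derivative $f'$ is of Schur's type of degree $n-1$, that is, with $m=n-1$, \[ f'(x)=\pm 1+d_1x+d_2\frac{x^2}{2!}+\dots+d_{m-1}\frac{x^{m-1}}{(m-1)!}\pm\frac{x^m}{m!} \] for some integers $d_1,\dots,d_{m-1}$ and some choice of the two (independent) signs; (ii) $f'$ is irreducible in $\mathbb{Q}[x]$; (iii) $f$ is indecomposable over $\mathbb{C}$, that is, $\deg f>1$ and there are no $g,h\in\mathbb{C}[x]$ with $\deg g>1$, $\deg h>1$ and $f(x)=g(h(x))$. -/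

import Mathlib

open Polynomial Nat

/-- A polynomial `f` over a field `K` is indecomposable (over `K`) if `deg f > 1` and `f` cannot be
written as `g(h(x))` with `g, h ∈ K[x]`, `deg g > 1` and `deg h > 1`. -/
def IsIndecomposable {K : Type*} [Field K] (f : K[X]) : Prop :=
  1 < f.natDegree ∧
    ∀ g h : K[X], f = g.comp h → ¬ (1 < g.natDegree ∧ 1 < h.natDegree)

/-- `S` is a polynomial of Schur's type of degree `m`:
`S = ± 1 + c₁ x + c₂ x² / 2! + ⋯ + cₘ₋₁ xᵐ⁻¹ / (m-1)! ± xᵐ / m!`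
with integers `cᵢ` and independent choices of the two signs. -/
def IsSchurType (m : ℕ) (S : ℚ[X]) : Prop :=
  1 ≤ m ∧ ∃ (ε δ : ℤ) (c : ℕ → ℤ), (ε = 1 ∨ ε = -1) ∧ (δ = 1 ∨ δ = -1) ∧
    S = C (ε : ℚ) + ∑ i ∈ Finset.Ico 1 m, C ((c i : ℚ) / (i ! : ℚ)) * X ^ i
      + C ((δ : ℚ) / (m ! : ℚ)) * X ^ m

/-! Termwise differentiation shows that `f'` is of Schur's type, so it is irreducible by Schur's
theorem. Suppose `f = g ∘ h` over ℂ with both degrees above 1. A linear change makes `h` monic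
without constant term. The top `deg h` coefficients of `g ∘ h` then determine `h` recursively, so
`h` is rational. By the chain rule `h'` divides `f'` over ℚ with `0 < deg h' < deg f'`, a
contradiction.

For Schur's theorem, scale to a monic integral `F` of degree `m` and take a monic factor `g` of
degree `k`, `1 ≤ k ≤ m / 2`. Sylvester gives a prime `p > k` dividing `C(m, k)`. This `p` divides
every coefficient of `F` of index at most `m - k`; the cofactor has degree only `m - k`, so `p ∣
g(0)`. On the other hand Legendre's formula makes the constant term of `F` dominate in the `p`-adic
Gauss norm of radius `c = p^(-1/(p-1))`. Dominance passes to `g`, so `c^k < |g(0)| ≤ 1/p = c^(p-1) ≤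
c^k`, which is absurd.

Sylvester's theorem follows Erdős: were all prime factors of `C(m, k)` at most `k`, then, each prime
power in it being at most `m`, the coefficient would be too small. Finite checks cover the remaining
small cases. -/

/-! ### Sylvester's theorem on products of consecutive integers -/

namespace Sylvester

/-- A lower bound for binomial coefficients: `C(m, k) ≥ (2m/k)^k / (2k)`. -/
theorem two_mul_pow_le {m k : ℕ} (hk : 1 ≤ k) (hm : 2 * k ≤ m) :
    (2 * m) ^ k ≤ 2 * k ^ (k + 1) * m.choose k := by
  -- Factor by factor, `(m - i) / (2k - i) ≥ m / (2k)` because `2k ≤ m`.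
  have h1 : m ^ k * (2 * k).descFactorial k ≤ (2 * k) ^ k * m.descFactorial k := by
    have hc (a : ℕ) : a ^ k = ∏ _i ∈ Finset.range k, a := by simp
    rw [descFactorial_eq_prod_range, descFactorial_eq_prod_range, hc m, hc (2 * k),
      ← Finset.prod_mul_distrib, ← Finset.prod_mul_distrib]
    refine Finset.prod_le_prod' fun i hi ↦ ?_
    rw [Nat.mul_sub, Nat.mul_sub, mul_comm m (2 * k)]
    exact Nat.sub_le_sub_left (Nat.mul_le_mul_right i hm) _
  rw [descFactorial_eq_factorial_mul_choose, descFactorial_eq_factorial_mul_choose] at h1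
  have h2 : m ^ k * (2 * k).choose k ≤ (2 * k) ^ k * m.choose k := by
    refine Nat.le_of_mul_le_mul_left ?_ (factorial_pos k)
    calc _ = m ^ k * (k ! * (2 * k).choose k) := by ring
      _ ≤ _ := h1
      _ = _ := by ring
  have h3 := four_pow_le_two_mul_self_mul_centralBinom k hk
  rw [centralBinom_eq_two_mul_choose] at h3
  refine Nat.le_of_mul_le_mul_left ?_ (pow_pos two_pos k)
  calc 2 ^ k * (2 * m) ^ k = 4 ^ k * m ^ k := by
        rw [← mul_pow, ← mul_pow]; congr 1; ring
    _ ≤ 2 * k * (2 * k).choose k * m ^ k := Nat.mul_le_mul_right _ h3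
    _ = 2 * k * (m ^ k * (2 * k).choose k) := by ring
    _ ≤ 2 * k * ((2 * k) ^ k * m.choose k) := Nat.mul_le_mul_left _ h2
    _ = _ := by rw [mul_pow]; ring

/-- If all prime factors of `C(m, k)` are at most `k`, its factorization only involves primes up
to `k`. -/
theorem prod_primesLE {m k : ℕ} (hm : k ≤ m)
    (h : ∀ p, p.Prime → p ∣ m.choose k → p ≤ k) :
    ∏ p ∈ (Finset.range (k + 1)).filter Nat.Prime, p ^ (m.choose k).factorization p =
      m.choose k := by
  conv_rhs => rw [← prod_pow_factorization_choose m k hm]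
  refine Finset.prod_subset (fun p hp ↦ ?_) fun p _ hp ↦ ?_
  · simp only [Finset.mem_filter, Finset.mem_range] at hp ⊢
    omega
  · by_cases h' : p.Prime ∧ p ∣ m.choose k
    · have := h p h'.1 h'.2
      simp only [Finset.mem_filter, Finset.mem_range, h'.1, and_true] at hp
      omega
    · have : (m.choose k).factorization p = 0 := by
        rw [factorization_eq_zero_iff]
        tauto
      rw [this, pow_zero]

theorem card_primes_range (s : ℕ) :
    ((Finset.range (s + 1)).filter Nat.Prime).card = s.primeCounting := by
  rw [primeCounting, primeCounting', count_eq_card_filter_range]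

theorem choose_le_pow_primeCounting {m k : ℕ} (hm : k ≤ m) (hm0 : 0 < m)
    (h : ∀ p, p.Prime → p ∣ m.choose k → p ≤ k) :
    m.choose k ≤ m ^ k.primeCounting := by
  rw [← prod_primesLE hm h, ← card_primes_range, ← Finset.prod_const]
  exact Finset.prod_le_prod' fun p _ ↦ pow_factorization_choose_le hm0

/-- Primes above `√m` occur at most once, and not at all when `3p > m`; a primorial bounds their
product. Each prime up to `√m` contributes at most `m`. -/
theorem choose_le_four_pow_mul {m k : ℕ} (hk : 2 ≤ k) (hm : 2 * k ≤ m)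
    (h : ∀ p, p.Prime → p ∣ m.choose k → p ≤ k) :
    m.choose k ≤ 4 ^ min k (m / 3) * m ^ m.sqrt.primeCounting := by
  classical
  -- This excludes `p = 2` among the primes above `√m`, where the vanishing for `m < 3p` could fail.
  have hs : 2 ≤ m.sqrt := by
    rw [Nat.le_sqrt]; omega
  rw [← prod_primesLE (by omega) h,
    ← Finset.prod_filter_mul_prod_filter_not _ (fun p ↦ m.sqrt < p)]
  refine Nat.mul_le_mul ?_ ?_
  · refine le_trans ?_ (primorial_le_four_pow _)
    rw [primorial]
    have key : ∀ p ∈ ((Finset.range (k + 1)).filter Nat.Prime).filter (fun p ↦ m.sqrt < p),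
        p ^ (m.choose k).factorization p ≤ if m < 3 * p then 1 else p := by
      intro p hp
      simp only [Finset.mem_filter, Finset.mem_range] at hp
      split_ifs with h3
      · rw [factorization_choose_of_lt_three_mul (by omega) (by omega) (by omega) h3, pow_zero]
      · have : (m.choose k).factorization p ≤ 1 :=
          factorization_choose_le_one (by rw [sq]; exact Nat.sqrt_lt.1 hp.2)
        calc _ ≤ p ^ 1 := Nat.pow_le_pow_right hp.1.2.pos this
          _ = p := pow_one p
    refine (Finset.prod_le_prod' key).trans ?_
    rw [Finset.prod_ite, Finset.prod_const_one, one_mul]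
    refine Finset.prod_le_prod_of_subset_of_one_le' (fun p hp ↦ ?_) fun p hp _ ↦ ?_
    · simp only [Finset.mem_filter, Finset.mem_range] at hp ⊢
      refine ⟨?_, hp.1.1.2⟩
      rw [Nat.lt_succ_iff, le_min_iff, Nat.le_div_iff_mul_le (by norm_num)]
      omega
    · simp only [Finset.mem_filter] at hp
      exact hp.2.pos
  · rw [← card_primes_range, ← Finset.prod_const]
    refine (Finset.prod_le_prod' fun p _ ↦
      pow_factorization_choose_le (by omega : 0 < m)).trans ?_
    refine Finset.prod_le_prod_of_subset_of_one_le' (fun p hp ↦ ?_) fun p hp _ ↦ by omega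
    simp only [Finset.mem_filter, Finset.mem_range] at hp ⊢
    exact ⟨by omega, hp.1.2⟩

/-- Primes above 3 are coprime to 6, hence lie in two of the six residue classes; counting from 61
on absorbs the rounding error. -/
theorem three_mul_primeCounting_le {k : ℕ} (hk : 37 ≤ k) : 3 * k.primeCounting ≤ k := by
  obtain hk' | hk' := lt_or_ge k 61
  · have : ∀ j ∈ Finset.Ico 37 61, 3 * j.primeCounting ≤ j := by decide +kernel
    exact this k (by simp; omega)
  · obtain ⟨n, rfl⟩ := Nat.exists_eq_add_of_le hk'
    have h1 := primeCounting'_add_le (a := 6) (k := 61) (by norm_num) (by norm_num) (n + 1)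
    have h2 : (61).primeCounting' = 17 := by decide +kernel
    have h3 : (6).totient = 2 := by decide +kernel
    rw [h2, h3] at h1
    rw [primeCounting, add_assoc]
    omega

/-- The case of small `k`, given a large enough `m`. -/
theorem false_of_small_of_large {m k : ℕ} (hk : 1 ≤ k) (hk' : k < 37) (hm : 120 ≤ m)
    (h : ∀ p, p.Prime → p ∣ m.choose k → p ≤ k) : False := by
  have h1 := choose_le_pow_primeCounting (by omega) (by omega) h
  have h2 := two_mul_pow_le hk (by omega : 2 * k ≤ m)
  -- It suffices to compare the two bounds at `m = 120`, since their ratio is a nonnegative power of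
  -- `m`.
  have h3 : ∀ j ∈ Finset.Ico 1 37, j ^ (j + 1) < 2 ^ (j - 1) * 120 ^ (j - j.primeCounting) ∧
      j.primeCounting ≤ j := by decide +kernel
  obtain ⟨h3, h4⟩ := h3 k (by simp; omega)
  have h5 : m ^ k = m ^ (k - k.primeCounting) * m ^ k.primeCounting := by
    rw [← pow_add]; congr 1; omega
  have h6 : 2 ^ k = 2 * 2 ^ (k - 1) := by rw [← pow_succ']; congr 1; omega
  have h7 : 2 * k ^ (k + 1) * m ^ k.primeCounting < (2 * m) ^ k := by
    calc 2 * k ^ (k + 1) * m ^ k.primeCounting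
        < 2 * (2 ^ (k - 1) * 120 ^ (k - k.primeCounting)) * m ^ k.primeCounting := by
          gcongr
      _ ≤ 2 * (2 ^ (k - 1) * m ^ (k - k.primeCounting)) * m ^ k.primeCounting := by gcongr
      _ = (2 * m) ^ k := by rw [mul_pow, h5, h6]; ring
  exact absurd (h2.trans (Nat.mul_le_mul_left _ h1)) (not_le.2 h7)

/-- The case where `m ≥ k ^ (3 / 2)`. -/
theorem false_of_cube_le_sq {m k : ℕ} (hk : 37 ≤ k) (hm : 2 * k ≤ m) (hkm : k ^ 3 ≤ m ^ 2)
    (h : ∀ p, p.Prime → p ∣ m.choose k → p ≤ k) : False := by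
  have h1 := choose_le_pow_primeCounting (by omega) (by omega) h
  have h2 := two_mul_pow_le (by omega) hm
  have h3 := three_mul_primeCounting_le hk
  set π := k.primeCounting
  have h4 : k ^ k ≤ m ^ (k - π) := by
    -- Cubing avoids the exponent in `k ≤ m^(2/3)`; then `3π ≤ k` gives `2k ≤ 3(k - π)`.
    refine le_of_pow_le_pow_left₀ (n := 3) (by norm_num) (by positivity) ?_
    calc (k ^ k) ^ 3 = (k ^ 3) ^ k := by rw [← pow_mul, ← pow_mul, mul_comm]
      _ ≤ (m ^ 2) ^ k := Nat.pow_le_pow_left hkm k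
      _ = m ^ (2 * k) := by rw [← pow_mul]
      _ ≤ m ^ ((k - π) * 3) := Nat.pow_le_pow_right (by omega) (by omega)
      _ = _ := by rw [← pow_mul]
  have h5 : 2 * k < 2 ^ k := by
    obtain ⟨j, rfl⟩ := Nat.exists_eq_add_of_le' (by omega : 3 ≤ k)
    have := (j + 1).lt_two_pow_self
    rw [pow_add] at *
    omega
  have h6 : 2 * k ^ (k + 1) * m ^ π < (2 * m) ^ k := by
    have hp : 0 < m ^ (k - π) * m ^ π := by
      have : 0 < m := by omega
      positivity
    calc 2 * k ^ (k + 1) * m ^ π = 2 * k * (k ^ k * m ^ π) := by ring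
      _ ≤ 2 * k * (m ^ (k - π) * m ^ π) := by gcongr
      _ < 2 ^ k * (m ^ (k - π) * m ^ π) := Nat.mul_lt_mul_of_pos_right h5 hp
      _ = (2 * m) ^ k := by
        rw [mul_pow, ← pow_add]; congr 2; omega
  exact absurd (h2.trans (Nat.mul_le_mul_left _ h1)) (not_le.2 h6)

/-- In a list of primes with gaps `b - a ≤ a ^ (2 / 3)`, every `m` in the covered range has a member
closely below it. -/
theorem exists_mem_of_isChain {m : ℕ} : ∀ (a : ℕ) (l : List ℕ),
    (a :: l).IsChain (fun a b ↦ (b - 1 - a) ^ 3 < a ^ 2) → a ≤ m → (∃ b ∈ l, m < b) →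
    ∃ q ∈ a :: l, q ≤ m ∧ (m - q) ^ 3 < q ^ 2
  | a, [], _, _, ⟨b, hb, _⟩ => by simp at hb
  | a, b :: l, hc, ha, ⟨c, hc', hmc⟩ => by
    rw [List.isChain_cons_cons] at hc
    obtain hb | hb := lt_or_ge m b
    · refine ⟨a, List.mem_cons_self, ha, lt_of_le_of_lt ?_ hc.1⟩
      exact Nat.pow_le_pow_left (by omega) 3
    · obtain ⟨q, hq, h⟩ := exists_mem_of_isChain b l hc.2 hb ⟨c, by
        rcases List.mem_cons.1 hc' with rfl | h
        · omega
        · exact h, hmc⟩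
      exact ⟨q, List.mem_cons_of_mem _ hq, h⟩

/-- When `m² < k³`, the bound forces `m - q < k`, so `q` is one of `m, …, m - k + 1`. The range
contains every `m` with `74 ≤ m < 1024^(3/2) = 32768`. -/
theorem exists_prime_sub_cube_lt {m : ℕ} (h : 73 ≤ m) (h' : m < 32999) :
    ∃ q, q.Prime ∧ q ≤ m ∧ (m - q) ^ 3 < q ^ 2 := by
  let l := [89, 109, 131, 157, 181, 211, 241, 277, 317, 359, 409, 463, 523, 587, 653, 727,
    797, 883, 971, 1069, 1171, 1283, 1399, 1523, 1637, 1759, 1901, 2053, 2213, 2383, 2557, 2741,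
    2927, 3121, 3331, 3547, 3779, 4021, 4273, 4523, 4793, 5077, 5351, 5657, 5953, 6277, 6607, 6959,
    7321, 7699, 8089, 8467, 8867, 9293, 9733, 10181, 10651, 11131, 11621, 12119, 12647, 13187,
    13729, 14303, 14891, 15497, 16111, 16747, 17401, 18061, 18749, 19447, 20161, 20899, 21649,
    22409, 23203, 24007, 24821, 25667, 26513, 27397, 28297, 29221, 30169, 31139, 32119, 32999]
  have hl : ∀ q ∈ 73 :: l, q.Prime := by
    simp only [l, List.forall_mem_cons, List.not_mem_nil]
    norm_num
  have hc : (73 :: l).IsChain (fun a b ↦ (b - 1 - a) ^ 3 < a ^ 2) := by decide +kernel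
  obtain ⟨q, hq, hqm⟩ := exists_mem_of_isChain 73 l hc h ⟨32999, by simp [l], h'⟩
  exact ⟨q, hl q hq, hqm⟩

/-- A prime `p > k` dividing one of `m, m - 1, …, m - k + 1` divides `C(m, k)`. -/
theorem prime_dvd_choose {m k i p : ℕ} (hp : p.Prime) (hi : i < k) (hk : k < p)
    (h : p ∣ m - i) : p ∣ m.choose k := by
  have h1 : p ∣ m.descFactorial k := by
    rw [descFactorial_eq_prod_range]
    exact h.trans (Finset.dvd_prod_of_mem _ (Finset.mem_range.2 hi))
  rw [descFactorial_eq_factorial_mul_choose, hp.dvd_mul] at h1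
  refine h1.resolve_left fun h2 ↦ ?_
  rw [hp.dvd_factorial] at h2
  omega

theorem exists_prime_of_lt_1024 {m k : ℕ} (hk : 37 ≤ k) (hk' : k < 1024) (hm : 2 * k ≤ m)
    (hkm : m ^ 2 < k ^ 3) : ∃ p, p.Prime ∧ k < p ∧ p ∣ m.choose k := by
  have hm' : m < 32768 := by
    refine lt_of_pow_lt_pow_left₀ 2 (by norm_num) ?_
    calc m ^ 2 < k ^ 3 := hkm
      _ ≤ 1024 ^ 3 := Nat.pow_le_pow_left hk'.le 3
      _ = 32768 ^ 2 := by norm_num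
  obtain ⟨q, hq, hqm, hlt⟩ := exists_prime_sub_cube_lt (by omega : 73 ≤ m) (by omega)
  have h1 : m - q < k := by
    refine lt_of_pow_lt_pow_left₀ 3 (by omega) ?_
    exact hlt.trans_le ((Nat.pow_le_pow_left hqm 2).trans hkm.le)
  refine ⟨q, hq, by omega, prime_dvd_choose (i := m - q) hq h1 (by omega) ?_⟩
  rw [Nat.sub_sub_self hqm]

theorem exists_prime_of_lt_37 {m k : ℕ} (hk : 1 ≤ k) (hk' : k < 37) (hm : 2 * k ≤ m)
    (hm' : m < 120) : ∃ p, p.Prime ∧ k < p ∧ p ∣ m.choose k := by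
  let l := [2, 3, 5, 7, 11, 13, 17, 19, 23, 29, 31, 37, 41, 43, 47, 53, 59, 61, 67, 71, 73, 79,
    83, 89, 97, 101, 103, 107, 109, 113]
  have hl : ∀ q ∈ l, q.Prime := by decide +kernel
  -- `m % p < k` says that a multiple of `p` lies among `m, …, m - k + 1`.
  have key : ∀ m ∈ Finset.range 120, ∀ k ∈ Finset.Ico 1 37, 2 * k ≤ m →
      ∃ p ∈ l, k < p ∧ m % p < k := by decide +kernel
  obtain ⟨p, hp, hkp, hmp⟩ := key m (by simpa using hm') k (by simp; omega) hm
  exact ⟨p, hl p hp, hkp, prime_dvd_choose (hl p hp) hmp hkp (Nat.dvd_sub_mod m)⟩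

/-! ### Logarithmic estimates for large `k` -/

theorem log_le_log_add_div_sub_one {x a : ℝ} (hx : 0 < x) (ha : 0 < a) :
    Real.log x ≤ Real.log a + (x / a - 1) := by
  have := Real.log_le_sub_one_of_pos (div_pos hx ha)
  rw [Real.log_div hx.ne' ha.ne'] at this
  linarith

theorem log_three_ge : (1.095 : ℝ) ≤ Real.log 3 := by
  have h1 : Real.log ((2 : ℝ) ^ 11 / 3 ^ 7) ≤ 2 ^ 11 / 3 ^ 7 - 1 :=
    Real.log_le_sub_one_of_pos (by norm_num)
  rw [Real.log_div (by norm_num) (by norm_num), Real.log_pow, Real.log_pow] at h1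
  have := Real.log_two_gt_d9
  norm_num at h1
  linarith

theorem log_three_le : Real.log 3 ≤ (1.1 : ℝ) := by
  have h1 : Real.log ((3 : ℝ) ^ 5 / 2 ^ 8) ≤ 3 ^ 5 / 2 ^ 8 - 1 :=
    Real.log_le_sub_one_of_pos (by norm_num)
  rw [Real.log_div (by norm_num) (by norm_num), Real.log_pow, Real.log_pow] at h1
  have := Real.log_two_lt_d9
  norm_num at h1
  linarith

theorem log_six : Real.log 6 = Real.log 2 + Real.log 3 := by
  rw [← Real.log_mul (by norm_num) (by norm_num)]; norm_num

/-- Concavity of the logarithm on `[4, 6]`. -/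
theorem log_two_mul_ge {y : ℝ} (h2 : 2 ≤ y) (h3 : y ≤ 3) :
    (3 - y) * Real.log 4 + (y - 2) * Real.log 6 ≤ Real.log (2 * y) := by
  have h4 : (4 : ℝ) ∈ Set.Ioi 0 := by norm_num
  have h6 : (6 : ℝ) ∈ Set.Ioi 0 := by norm_num
  have := strictConcaveOn_log_Ioi.concaveOn.2 h4 h6 (sub_nonneg.2 h3) (sub_nonneg.2 h2) (by ring)
  simp only [smul_eq_mul] at this
  rwa [show (3 - y) * 4 + (y - 2) * 6 = 2 * y by ring] at this

/-- With `y = m / k`, the chord of the logarithm on `2 ≤ y ≤ 3` reduces the claim to `y = 2` and `y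
= 3`. The tighter end leaves `log 6 - log 4 > 0.4`. -/
theorem log_bound_of_lt {k m : ℝ} (hk : 0 < k) (hm : 2 * k ≤ m) :
    0.4 * k + min k (m / 3) * Real.log 4 ≤ k * Real.log (2 * m / k) := by
  have l2 := Real.log_two_gt_d9
  have l2' := Real.log_two_lt_d9
  have l3 := log_three_ge
  have l6 := log_six
  have l4 : Real.log 4 = 2 * Real.log 2 := by
    rw [show (4 : ℝ) = 2 ^ 2 by norm_num, Real.log_pow]; norm_num
  obtain ⟨y, rfl⟩ : ∃ y, m = y * k := ⟨m / k, by field_simp⟩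
  have h2 : 2 ≤ y := le_of_mul_le_mul_right hm hk
  have e : 2 * (y * k) / k = 2 * y := by field_simp
  rw [e]
  suffices h : ∃ z, min k (y * k / 3) = z * k ∧ 0.4 + z * Real.log 4 ≤ Real.log (2 * y) by
    obtain ⟨z, hz, h⟩ := h
    rw [hz]
    nlinarith
  obtain h3 | h3 := le_total y 3
  · refine ⟨y / 3, ?_, ?_⟩
    · rw [min_eq_right (by nlinarith)]; ring
    · have := log_two_mul_ge h2 h3
      rw [l4, l6] at this
      rw [l4]
      nlinarith
  · refine ⟨1, ?_, ?_⟩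
    · rw [min_eq_left (by nlinarith)]; ring
    · have : Real.log 6 ≤ Real.log (2 * y) := Real.log_le_log (by norm_num) (by linarith)
      rw [l4]
      linarith

/-- The case of large `k` and `m < k ^ (3 / 2)`. -/
theorem false_of_sq_lt_cube {m k : ℕ} (hk : 1024 ≤ k) (hm : 2 * k ≤ m) (hkm : m ^ 2 < k ^ 3)
    (h : ∀ p, p.Prime → p ∣ m.choose k → p ≤ k) : False := by
  have h1 := choose_le_four_pow_mul (by omega) hm h
  have h2 := (two_mul_pow_le (by omega) hm).trans (Nat.mul_le_mul_left _ h1)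
  have hs : 37 ≤ m.sqrt := by rw [Nat.le_sqrt]; omega
  have h3 := three_mul_primeCounting_le hs
  have hs' : (m.sqrt : ℝ) ≤ √m := Real.nat_sqrt_le_real_sqrt
  have hk0 : (1024 : ℝ) ≤ k := by exact_mod_cast hk
  have hm0 : (2 : ℝ) * k ≤ m := by exact_mod_cast hm
  have hkm' : (m : ℝ) ^ 2 < k ^ 3 := by exact_mod_cast hkm
  have hkp : (0 : ℝ) < k := by linarith
  have hmp : (0 : ℝ) < m := by linarith
  have l2 := Real.log_two_gt_d9
  have l2' := Real.log_two_lt_d9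
  have l3 := log_three_ge
  have l3' := log_three_le
  have l6 := log_six
  have lm : 0 < Real.log m := Real.log_pos (by linarith)
  have lk : 0 < Real.log k := Real.log_pos (by linarith)
  have h4 : k * Real.log (2 * m / k) ≤
      Real.log 2 + Real.log k + min (k : ℝ) (m / 3) * Real.log 4 + √m / 3 * Real.log m := by
    have h5 : ((2 * m : ℝ)) ^ k ≤
        2 * k ^ (k + 1) * (4 ^ min k (m / 3) * m ^ m.sqrt.primeCounting) := by
      exact_mod_cast h2
    have h6 := Real.log_le_log (by positivity) h5
    rw [Real.log_mul (by positivity) (by positivity), Real.log_mul (by positivity) (by positivity),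
      Real.log_mul (by positivity) (by positivity), Real.log_pow, Real.log_pow, Real.log_pow,
      Real.log_pow] at h6
    rw [Real.log_div (by positivity) (by positivity)]
    have h7 : ((min k (m / 3) : ℕ) : ℝ) ≤ min (k : ℝ) (m / 3) := by
      rw [Nat.cast_min]
      exact min_le_min_left _ (by exact_mod_cast Nat.cast_div_le (α := ℝ))
    have h8 : (m.sqrt.primeCounting : ℝ) ≤ √m / 3 := by
      have : (3 : ℝ) * m.sqrt.primeCounting ≤ m.sqrt := by exact_mod_cast h3
      linarith
    have h9 := mul_le_mul_of_nonneg_right h7 (Real.log_nonneg (by norm_num : (1 : ℝ) ≤ 4))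
    have h10 := mul_le_mul_of_nonneg_right h8 lm.le
    push_cast at h6 h9
    linarith
  -- Below `6k` the surplus `0.4 k` beats `√m log m`, with `√6 < 2.45`. From `6k` on, `2m / k ≥ 12`
  -- leaves a surplus `k log 3`, enough even for `m` near `k^(3/2)`; there `t = k^(1/4)`, and `5.6⁴
  -- < 1024`.
  obtain hc | hc := lt_or_ge (m : ℝ) (6 * k)
  · have h5 := log_bound_of_lt hkp hm0
    obtain ⟨t, ht, hkt⟩ : ∃ t : ℝ, 32 ≤ t ∧ (k : ℝ) = t ^ 2 :=
      ⟨√k, Real.le_sqrt_of_sq_le (by linarith), (Real.sq_sqrt hkp.le).symm⟩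
    have h6 : √(m : ℝ) ≤ 2.45 * t := by
      refine Real.sqrt_le_iff.2 ⟨by linarith, ?_⟩
      nlinarith
    have h7 : Real.log m ≤ Real.log 6 + Real.log k := by
      rw [← Real.log_mul (by norm_num) hkp.ne']
      exact Real.log_le_log hmp hc.le
    have h8 := log_le_log_add_div_sub_one (by linarith : 0 < t) (by norm_num : (0 : ℝ) < 32)
    have h9 : Real.log k = 2 * Real.log t := by rw [hkt, Real.log_pow]; norm_num
    have h10 : Real.log 32 = 5 * Real.log 2 := by
      rw [show (32 : ℝ) = 2 ^ 5 by norm_num, Real.log_pow]; norm_num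
    have h11 : Real.log m ≤ 6.74 + t / 16 := by linarith
    have h12 : √(m : ℝ) / 3 * Real.log m ≤ 2.45 * t / 3 * (6.74 + t / 16) := by gcongr
    have h13 : 0.4 * (k : ℝ) ≤ 0.7 + 2 * (2.5 + t / 32) + 2.45 * t / 3 * (6.74 + t / 16) := by
      linarith
    rw [hkt] at h13
    nlinarith only [h13, ht]
  · have h5 : k * (Real.log 3 + Real.log 4) ≤ k * Real.log (2 * m / k) := by
      refine mul_le_mul_of_nonneg_left ?_ hkp.le
      rw [← Real.log_mul (by norm_num) (by norm_num)]
      refine Real.log_le_log (by norm_num) ?_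
      rw [le_div_iff₀ hkp]
      linarith
    have h6 : min (k : ℝ) (m / 3) * Real.log 4 ≤ k * Real.log 4 :=
      mul_le_mul_of_nonneg_right (min_le_left _ _) (Real.log_nonneg (by norm_num))
    obtain ⟨t, ht, hkt⟩ : ∃ t : ℝ, 5.6 ≤ t ∧ (k : ℝ) = t ^ 4 := by
      refine ⟨√√k, Real.le_sqrt_of_sq_le (Real.le_sqrt_of_sq_le ?_), ?_⟩
      · norm_num; linarith
      · rw [show (4 : ℕ) = 2 * 2 by norm_num, pow_mul, Real.sq_sqrt (Real.sqrt_nonneg _),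
          Real.sq_sqrt hkp.le]
    have ht0 : 0 < t := by linarith
    have h7 : (m : ℝ) ≤ t ^ 6 := by
      refine le_of_pow_le_pow_left₀ (n := 2) (by norm_num) (by positivity) (hkm'.le.trans_eq ?_)
      rw [hkt]; ring
    have h8 : √(m : ℝ) ≤ t ^ 3 := by
      refine Real.sqrt_le_iff.2 ⟨by positivity, h7.trans_eq (by ring)⟩
    have h9 : Real.log m ≤ 6 * Real.log t := by
      have := Real.log_le_log hmp h7
      rwa [Real.log_pow] at this
    have h10 := log_le_log_add_div_sub_one ht0 (by norm_num : (0 : ℝ) < 6)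
    have h11 : Real.log k = 4 * Real.log t := by rw [hkt, Real.log_pow]; norm_num
    have h12 : Real.log t ≤ 0.8 + t / 6 := by linarith
    have h13 : √(m : ℝ) / 3 * Real.log m ≤ t ^ 3 / 3 * (6 * (0.8 + t / 6)) := by
      gcongr
      linarith
    have h14 : t ^ 4 * 1.095 ≤ k * Real.log 3 := by rw [hkt]; gcongr
    have h15 : t ^ 4 * 1.095 ≤ 0.7 + 4 * (0.8 + t / 6) + t ^ 3 / 3 * (6 * (0.8 + t / 6)) := by
      linarith
    have h16 : 5.6 * t ^ 3 ≤ t ^ 4 := by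
      rw [pow_succ' t 3]
      exact mul_le_mul_of_nonneg_right ht (by positivity)
    have h17 : 31 * t ≤ t ^ 3 := by
      rw [pow_succ t 2]
      exact mul_le_mul_of_nonneg_right (by nlinarith only [ht]) ht0.le
    have h18 : t ^ 3 / 3 * (6 * (0.8 + t / 6)) = 1.6 * t ^ 3 + t ^ 4 / 3 := by ring
    linarith only [h15, h16, h17, h18, ht]

/-- **Sylvester's theorem** (Sylvester–Schur, Erdős): for `1 ≤ k` and `2 * k ≤ m`, the binomial
coefficient `C(m, k)` has a prime factor larger than `k`. -/
theorem exists_prime_dvd_choose {m k : ℕ} (hk : 1 ≤ k) (hm : 2 * k ≤ m) :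
    ∃ p, p.Prime ∧ k < p ∧ p ∣ m.choose k := by
  by_contra! hcon
  have h : ∀ p, p.Prime → p ∣ m.choose k → p ≤ k :=
    fun p hp hd ↦ not_lt.1 fun hlt ↦ hcon p hp hlt hd
  obtain hk1 | hk1 := lt_or_ge k 37
  · obtain hm1 | hm1 := lt_or_ge m 120
    · obtain ⟨p, hp, hkp, hd⟩ := exists_prime_of_lt_37 hk hk1 hm hm1
      exact hcon p hp hkp hd
    · exact false_of_small_of_large hk hk1 hm1 h
  · obtain hkm | hkm := le_or_gt (k ^ 3) (m ^ 2)
    · exact false_of_cube_le_sq hk1 hm hkm h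
    · obtain hk2 | hk2 := lt_or_ge k 1024
      · obtain ⟨p, hp, hkp, hd⟩ := exists_prime_of_lt_1024 hk1 hk2 hm hkm
        exact hcon p hp hkp hd
      · exact false_of_sq_lt_cube hk2 hm hkm h

end Sylvester

/-! ### Dominant constant terms over ultrametric fields -/

/-- The last index where a weighted coefficient norm is maximal. -/
theorem Polynomial.exists_last_max {K : Type*} [NormedField K] {f : K[X]} (hf : f ≠ 0) {c : ℝ}
    (hc : 0 < c) : ∃ i, 0 < ‖f.coeff i‖ * c ^ i ∧
      (∀ j, ‖f.coeff j‖ * c ^ j ≤ ‖f.coeff i‖ * c ^ i) ∧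
      ∀ j, i < j → ‖f.coeff j‖ * c ^ j < ‖f.coeff i‖ * c ^ i := by
  -- The lexicographic order breaks ties in favour of the larger index.
  obtain ⟨i, hi, hmax⟩ := f.support.exists_max_image
    (fun j ↦ toLex (‖f.coeff j‖ * c ^ j, j)) (by simpa using hf)
  have hpos : 0 < ‖f.coeff i‖ * c ^ i :=
    mul_pos (norm_pos_iff.2 (mem_support_iff.1 hi)) (pow_pos hc i)
  refine ⟨i, hpos, fun j ↦ ?_, fun j hij ↦ ?_⟩
  · by_cases hj : j ∈ f.support
    · have := hmax j hj
      rw [Prod.Lex.toLex_le_toLex] at this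
      rcases this with h | h
      · exact h.le
      · exact h.1.le
    · rw [notMem_support_iff.1 hj, norm_zero, zero_mul]
      exact hpos.le
  · by_cases hj : j ∈ f.support
    · have := hmax j hj
      rw [Prod.Lex.toLex_le_toLex] at this
      rcases this with h | h
      · exact h
      · exact absurd h.2 (not_le.2 hij)
    · rw [notMem_support_iff.1 hj, norm_zero, zero_mul]
      exact hpos

/-- If the constant term of a product strictly dominates for a Gauss norm, so does the constant term
of each factor. -/
theorem Polynomial.norm_coeff_lt_of_mul {K : Type*} [NormedField K] [IsUltrametricDist K]
    {f g : K[X]} {c : ℝ} (hc : 0 < c) (hf : f ≠ 0) (hg : g ≠ 0)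
    (h : ∀ i, 0 < i → ‖(f * g).coeff i‖ * c ^ i < ‖(f * g).coeff 0‖) (i : ℕ) (hi : 0 < i) :
    ‖g.coeff i‖ * c ^ i < ‖g.coeff 0‖ := by
  obtain ⟨a, ha0, ha, ha'⟩ := exists_last_max hf hc
  obtain ⟨b, hb0, hb, hb'⟩ := exists_last_max hg hc
  have hfg (i j : ℕ) : ‖f.coeff i * g.coeff j‖ * c ^ (i + j) =
      (‖f.coeff i‖ * c ^ i) * (‖g.coeff j‖ * c ^ j) := by
    rw [norm_mul, pow_add]; ring
  have hdom : ‖(f * g).coeff (a + b)‖ * c ^ (a + b) =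
      (‖f.coeff a‖ * c ^ a) * (‖g.coeff b‖ * c ^ b) := by
    rw [← hfg, coeff_mul, ← Finset.add_sum_erase _ _
      (show (a, b) ∈ Finset.HasAntidiagonal.antidiagonal (a + b) by simp)]
    congr 1
    have hmain : 0 < ‖f.coeff a * g.coeff b‖ := by
      have := mul_pos ha0 hb0
      rw [← hfg] at this
      exact pos_of_mul_pos_left this (by positivity)
    have hrest : ‖∑ x ∈ (Finset.HasAntidiagonal.antidiagonal (a + b)).erase (a, b), f.coeff x.1 * g.coeff x.2‖ <
        ‖f.coeff a * g.coeff b‖ := by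
      obtain ⟨x, hx, hle⟩ := IsUltrametricDist.exists_norm_finsetSum_le
        ((Finset.HasAntidiagonal.antidiagonal (a + b)).erase (a, b)) fun x ↦ f.coeff x.1 * g.coeff x.2
      obtain hE | hE := ((Finset.HasAntidiagonal.antidiagonal (a + b)).erase (a, b)).eq_empty_or_nonempty
      · rw [hE, Finset.sum_empty, norm_zero]
        exact hmain
      · refine hle.trans_lt ?_
        have hx := hx hE
        rw [Finset.mem_erase, Finset.HasAntidiagonal.mem_antidiagonal] at hx
        obtain ⟨hne, hsum⟩ := hx
        refine lt_of_mul_lt_mul_right ?_ (pow_pos hc (a + b)).le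
        rw [hfg, ← hsum, hfg]
        -- Any other pair of the same sum exceeds `a` or `b`, where the maximality is strict; hence
        -- no cancellation.
        have hor : a < x.1 ∨ b < x.2 := by
          by_contra! hcon
          exact hne (Prod.ext (by omega) (by omega))
        rcases hor with hlt | hlt
        · exact mul_lt_mul_of_lt_of_le_of_nonneg_of_pos (ha' _ hlt) (hb _) (by positivity) hb0
        · exact mul_lt_mul_of_le_of_lt_of_nonneg_of_pos (ha _) (hb' _ hlt) (by positivity) ha0
    rw [IsUltrametricDist.norm_add_eq_max_of_norm_ne_norm hrest.ne', max_eq_left hrest.le]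
  have hab : a + b = 0 := by
    by_contra hne
    have h1 := h (a + b) (Nat.pos_of_ne_zero hne)
    rw [hdom, mul_coeff_zero, norm_mul] at h1
    have h2 := ha 0
    have h3 := hb 0
    rw [pow_zero, mul_one] at h2 h3
    exact absurd (mul_le_mul h2 h3 (norm_nonneg _) ha0.le) (not_le.2 h1)
  obtain rfl : b = 0 := by omega
  simpa using hb' i hi

/-! ### Schur's irreducibility theorem -/

theorem exists_pow_eq_inv_prime {p : ℕ} (hp : p.Prime) :
    ∃ c : ℝ, 0 < c ∧ c < 1 ∧ c ^ (p - 1) = (p : ℝ)⁻¹ := by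
  have hp1 : p - 1 ≠ 0 := by have := hp.two_le; omega
  have hp0 : (0 : ℝ) < (p : ℝ)⁻¹ := by
    have := hp.pos
    positivity
  refine ⟨((p : ℝ)⁻¹) ^ (((p - 1 : ℕ) : ℝ)⁻¹), by positivity, ?_, ?_⟩
  · refine Real.rpow_lt_one hp0.le (inv_lt_one_of_one_lt₀ (by exact_mod_cast hp.one_lt)) ?_
    positivity
  · rw [Real.rpow_inv_natCast_pow hp0.le hp1]

/-- Legendre's bound `v_p(i!) < i / (p - 1)` in terms of norms. -/
theorem pow_lt_norm_factorial {p : ℕ} [hp : Fact p.Prime] {c : ℝ} (hc0 : 0 < c) (hc1 : c < 1)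
    (hc : c ^ (p - 1) = (p : ℝ)⁻¹) {i : ℕ} (hi : 0 < i) : c ^ i < ‖((i ! : ℕ) : ℚ_[p])‖ := by
  -- Legendre: `(p - 1) v_p(i!)` is `i` minus its digit sum in base `p`, which is positive.
  have h1 := sub_one_mul_padicValNat_factorial (p := p) i
  have h2 : 0 < (p.digits i).sum := by
    by_contra! h
    have h0 : ∀ d ∈ p.digits i, d = 0 := List.sum_eq_zero_iff.1 (Nat.le_zero.1 h)
    exact Nat.getLast_digit_ne_zero p hi.ne' (h0 _ (List.getLast_mem _))
  have h3 : ‖((i ! : ℕ) : ℚ_[p])‖ = c ^ ((p - 1) * padicValNat p i !) := by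
    rw [pow_mul, hc, Padic.norm_eq_zpow_neg_valuation (by exact_mod_cast (factorial_pos i).ne'),
      Padic.valuation_natCast, zpow_neg, zpow_natCast, inv_pow]
  rw [h3]
  exact pow_lt_pow_right_of_lt_one₀ hc0 hc1 (by omega)

/-- If `X ^ j` divides `f * g` modulo `p`, `f` is monic and `deg f < j`, then `p ∣ g(0)`. -/
theorem Polynomial.dvd_coeff_zero_of_monic {p : ℕ} (hp : p.Prime) {f g : ℤ[X]} (hf : f.Monic)
    {j : ℕ} (hj : f.natDegree < j) (h : ∀ i < j, (p : ℤ) ∣ (f * g).coeff i) :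
    (p : ℤ) ∣ g.coeff 0 := by
  have : Fact p.Prime := ⟨hp⟩
  by_contra hg
  let ψ := Int.castRingHom (ZMod p)
  have h1 : (X : (ZMod p)[X]) ^ j ∣ f.map ψ * g.map ψ := by
    rw [← Polynomial.map_mul, X_pow_dvd_iff]
    intro i hi
    rw [coeff_map]
    exact (ZMod.intCast_zmod_eq_zero_iff_dvd _ p).2 (h i hi)
  have h2 : ¬ (X : (ZMod p)[X]) ∣ g.map ψ := by
    rw [X_dvd_iff, coeff_map]
    exact fun h ↦ hg ((ZMod.intCast_zmod_eq_zero_iff_dvd _ p).1 h)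
  -- As `X` is prime and misses `g` modulo `p`, all of `X ^ j` divides `f`, against its degree.
  have h3 := prime_X.pow_dvd_of_dvd_mul_right j h2 h1
  have h4 := natDegree_le_of_dvd h3 (hf.map ψ).ne_zero
  rw [natDegree_X_pow, hf.natDegree_map] at h4
  omega

/-- Integral form of **Schur's theorem**: a monic polynomial of degree `m` whose `i`-th coefficient
is divisible by `m! / i!`, with constant term `± m!`, is irreducible. -/
theorem Polynomial.Monic.irreducible_of_factorial_dvd {F : ℤ[X]} (hF : F.Monic)
    (hm : 1 ≤ F.natDegree)
    (hi : ∀ i ≤ F.natDegree, ∃ d : ℤ, (i ! : ℤ) * F.coeff i = F.natDegree ! * d)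
    (h0 : (F.coeff 0).natAbs = F.natDegree !) : Irreducible F := by
  rw [hF.irreducible_iff_natDegree']
  refine ⟨fun h ↦ by simp [h] at hm, ?_⟩
  rintro f g hf hg hfg hk
  rw [Finset.mem_Ioc] at hk
  set m := F.natDegree with hmdef
  set k := g.natDegree with hkdef
  have hdeg : f.natDegree + k = m := by rw [hmdef, ← hfg, hf.natDegree_mul hg]
  obtain ⟨p, hp, hkp, hpd⟩ := Sylvester.exists_prime_dvd_choose hk.1 (by omega : 2 * k ≤ m)
  have : Fact p.Prime := ⟨hp⟩
  have hpg : (p : ℤ) ∣ g.coeff 0 := by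
    refine dvd_coeff_zero_of_monic hp hf (lt_succ_self f.natDegree) fun i hi' ↦ ?_
    rw [hfg]
    obtain ⟨d, hd⟩ := hi i (by omega)
    have h1 := factorial_mul_descFactorial (by omega : k ≤ m)
    -- For `i ≤ m - k`, the quotient `m! / i!` is a multiple of `m (m - 1) ⋯ (m - k + 1)`, hence of
    -- `p`.
    obtain ⟨e, he⟩ := factorial_dvd_factorial (by omega : i ≤ m - k)
    rw [he] at h1
    have h2 : F.coeff i = e * m.descFactorial k * d := by
      refine mul_left_cancel₀ (by exact_mod_cast (factorial_pos i).ne' : (i ! : ℤ) ≠ 0) ?_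
      rw [hd, ← h1]
      push_cast
      ring
    have h3 : (p : ℤ) ∣ m.descFactorial k := by
      rw [descFactorial_eq_factorial_mul_choose]
      exact_mod_cast hpd.mul_left _
    rw [h2]
    exact (h3.mul_left _).mul_right _
  obtain ⟨c, hc0, hc1, hc⟩ := exists_pow_eq_inv_prime hp
  let ψ := Int.castRingHom ℚ_[p]
  have hdom : ‖(g.map ψ).coeff k‖ * c ^ k < ‖(g.map ψ).coeff 0‖ := by
    refine norm_coeff_lt_of_mul hc0 (hf.map ψ).ne_zero (hg.map ψ).ne_zero (fun i hi0 ↦ ?_) k hk.1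
    rw [← Polynomial.map_mul, hfg, coeff_map, coeff_map]
    have hF0 : ‖ψ (F.coeff 0)‖ = ‖((m ! : ℕ) : ℚ_[p])‖ := by
      rw [← h0]
      rcases Int.natAbs_eq (F.coeff 0) with h | h
      · rw [h]; simp [ψ]
      · rw [h]; simp [ψ]
    obtain hFi | hFi := eq_or_ne (F.coeff i) 0
    · rw [hFi, map_zero, norm_zero, zero_mul, hF0, norm_pos_iff]
      exact_mod_cast (factorial_pos m).ne'
    obtain ⟨d, hd⟩ := hi i (le_natDegree_of_ne_zero hFi)
    have h1 : ‖((i ! : ℕ) : ℚ_[p])‖ * ‖ψ (F.coeff i)‖ = ‖((m ! : ℕ) : ℚ_[p])‖ * ‖(d : ℚ_[p])‖ := by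
      rw [← norm_mul, ← norm_mul]
      congr 1
      simp only [ψ, eq_intCast]
      exact_mod_cast hd
    have h2 : 0 < ‖ψ (F.coeff i)‖ := by
      rw [norm_pos_iff]
      simpa [ψ] using hFi
    calc ‖ψ (F.coeff i)‖ * c ^ i < ‖ψ (F.coeff i)‖ * ‖((i ! : ℕ) : ℚ_[p])‖ :=
          mul_lt_mul_of_pos_left (pow_lt_norm_factorial hc0 hc1 hc hi0) h2
      _ = ‖((m ! : ℕ) : ℚ_[p])‖ * ‖(d : ℚ_[p])‖ := by rw [mul_comm, h1]
      _ ≤ ‖ψ (F.coeff 0)‖ := by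
        rw [hF0]
        exact mul_le_of_le_one_right (norm_nonneg _) (Padic.norm_int_le_one d)
  rw [coeff_map, coeff_map, hg.coeff_natDegree, map_one, norm_one, one_mul] at hdom
  have h2 : ‖ψ (g.coeff 0)‖ ≤ (p : ℝ)⁻¹ := by
    obtain ⟨d, hd⟩ := hpg
    rw [hd, map_mul, norm_mul]
    simp only [ψ, eq_intCast, Int.cast_natCast, Padic.norm_p]
    exact mul_le_of_le_one_right (by positivity) (Padic.norm_int_le_one d)
  have h3 : (p : ℝ)⁻¹ ≤ c ^ k := by
    rw [← hc]
    exact pow_le_pow_of_le_one hc0.le hc1.le (by omega)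
  linarith

/-- **Schur's irreducibility theorem.** -/
theorem IsSchurType.irreducible {m : ℕ} {S : ℚ[X]} (h : IsSchurType m S) : Irreducible S := by
  obtain ⟨hm, ε, δ, c, hε, hδ, rfl⟩ := h
  have hδ2 : δ * δ = 1 := by rcases hδ with rfl | rfl <;> rfl
  -- `X ^ m + Q` is `δ m! S`, the monic integral multiple of `S`.
  set Q : ℤ[X] := C (δ * ε * m !) +
    ∑ i ∈ Finset.Ico 1 m, C (δ * c i * ((m ! / i ! : ℕ) : ℤ)) * X ^ i with hQ
  have hQc (i : ℕ) : Q.coeff i = (if i = 0 then δ * ε * m ! else 0) +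
      if i ∈ Finset.Ico 1 m then δ * c i * ((m ! / i ! : ℕ) : ℤ) else 0 := by
    simp only [hQ, coeff_add, coeff_C, finsetSum_coeff, coeff_C_mul_X_pow, Finset.sum_ite_eq]
  have hQd : Q.degree < m := by
    rw [degree_lt_iff_coeff_zero]
    intro i hi
    rw [hQc, if_neg (by omega), if_neg (by simp; omega), add_zero]
  have hF := monic_X_pow_add hQd
  have hFd : (X ^ m + Q).natDegree = m :=
    natDegree_eq_of_degree_eq_some (by
      rw [degree_add_eq_left_of_degree_lt (by rwa [degree_X_pow]), degree_X_pow])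
  have hirr : Irreducible (X ^ m + Q) := by
    refine hF.irreducible_of_factorial_dvd (by omega) (fun i hi ↦ ?_) ?_
    · rw [hFd] at hi ⊢
      rw [coeff_add, coeff_X_pow, hQc]
      obtain rfl | hi0 := eq_or_ne i 0
      · refine ⟨δ * ε, ?_⟩
        rw [if_neg (by omega), if_pos rfl, if_neg (by simp)]
        simp
        ring
      · obtain rfl | him := eq_or_ne i m
        · exact ⟨1, by simp [hi0]⟩
        · refine ⟨δ * c i, ?_⟩
          rw [if_neg him, if_neg hi0, if_pos (by simp; omega)]
          have : ((i ! : ℕ) : ℤ) * ((m ! / i ! : ℕ) : ℤ) = (m ! : ℕ) := by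
            exact_mod_cast Nat.mul_div_cancel' (factorial_dvd_factorial hi)
          rw [← this]
          ring
    · rw [hFd, coeff_add, coeff_X_pow, hQc, if_neg (by omega), if_pos rfl, if_neg (by simp)]
      rcases hδ with rfl | rfl <;> rcases hε with rfl | rfl <;> simp
  rw [hF.irreducible_iff_irreducible_map_fraction_map (K := ℚ)] at hirr
  have hmf : (m ! : ℚ) ≠ 0 := by exact_mod_cast (factorial_pos m).ne'
  have hδ0 : (δ : ℚ) ≠ 0 := by rcases hδ with rfl | rfl <;> norm_num
  have hu : IsUnit (C ((δ : ℚ) * m !)) := by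
    rw [isUnit_C, isUnit_iff_ne_zero]
    exact mul_ne_zero hδ0 hmf
  rw [← irreducible_isUnit_mul hu]
  convert hirr using 1
  simp only [hQ, Polynomial.map_add, Polynomial.map_pow, map_X, Polynomial.map_sum,
    Polynomial.map_mul, map_C, algebraMap_int_eq, mul_add, Finset.mul_sum, ← mul_assoc,
    ← C_mul]
  rw [add_comm (X ^ m)]
  congr 1
  · congr 1
    · congr 1
      simp only [eq_intCast]
      push_cast
      ring
    · refine Finset.sum_congr rfl fun i hi ↦ ?_
      rw [Finset.mem_Ico] at hi
      congr 2
      have hif : (i ! : ℚ) ≠ 0 := by exact_mod_cast (factorial_pos i).ne'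
      rw [eq_intCast, Int.cast_mul, Int.cast_mul, Int.cast_natCast,
        Nat.cast_div (factorial_dvd_factorial hi.2.le) hif]
      ring
  · have : (δ : ℚ) * m ! * (δ / m !) = 1 := by
      field_simp
      exact_mod_cast (sq δ).trans hδ2
    rw [this, C_1, one_mul]

/-! ### Descent of decompositions -/

section Descent

variable {K L : Type*} [Field K] [Field L] [Algebra K L]

/-- The coefficients of `g ∘ h` in the top `deg h` degrees only depend on the leading term of
`g`. -/
theorem Polynomial.coeff_comp_of_monic {g h : L[X]} (hh : h.Monic) {j : ℕ}
    (hj : j < h.natDegree) :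
    (g.comp h).coeff (g.natDegree * h.natDegree - j) =
      g.leadingCoeff * (h ^ g.natDegree).coeff (g.natDegree * h.natDegree - j) := by
  rw [comp, eval₂_eq_sum_range, finsetSum_coeff, Finset.sum_range_succ, coeff_C_mul,
    coeff_natDegree, add_eq_right]
  refine Finset.sum_eq_zero ?_
  intro i hi
  rw [Finset.mem_range] at hi
  rw [coeff_C_mul, coeff_eq_zero_of_natDegree_lt (p := h ^ i), mul_zero]
  rw [hh.natDegree_pow]
  have := Nat.mul_le_mul_right h.natDegree (Nat.succ_le_of_lt hi)
  rw [Nat.succ_mul] at this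
  omega

/-- Each factor `t` in place of `q` lowers the degree by at least `j`, so terms with two or more of
them stay below this index. -/
theorem Polynomial.coeff_add_pow_of_monic {q t : L[X]} (hq : q.Monic) {j r : ℕ} (hj : 0 < j)
    (hjq : j < q.natDegree) (hr : 0 < r) (ht : t.natDegree ≤ q.natDegree - j) :
    ((q + t) ^ r).coeff (r * q.natDegree - j) =
      (q ^ r).coeff (r * q.natDegree - j) + r * t.coeff (q.natDegree - j) := by
  obtain ⟨r, rfl⟩ := Nat.exists_eq_add_of_le' hr
  set s := q.natDegree
  have hs : (r + 1) * s - j = r * s + (s - j) := by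
    rw [Nat.succ_mul]
    omega
  rw [add_pow, finsetSum_coeff, Finset.sum_range_succ, Finset.sum_range_succ, Finset.sum_eq_zero]
  · rw [zero_add, add_comm]
    congr 1
    · simp
    · rw [Nat.add_sub_cancel_left, pow_one, Nat.choose_succ_self_right, ← C_eq_natCast,
        coeff_mul_C, hs, coeff_mul_add_eq_of_natDegree_le (by rw [hq.natDegree_pow]) ht, ← hq.natDegree_pow,
        (hq.pow r).coeff_natDegree, one_mul, mul_comm]
  · intro i hi
    rw [Finset.mem_range] at hi
    rw [← C_eq_natCast, coeff_mul_C, coeff_eq_zero_of_natDegree_lt, zero_mul]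
    refine natDegree_mul_le.trans_lt ?_
    rw [hq.natDegree_pow]
    have h1 : (t ^ (r + 1 - i)).natDegree ≤ (r + 1 - i) * (s - j) :=
      natDegree_pow_le.trans (Nat.mul_le_mul_left _ ht)
    obtain ⟨l, rfl⟩ : ∃ l, r = i + 1 + l := Nat.exists_eq_add_of_le hi
    obtain ⟨u, hu⟩ := Nat.exists_eq_add_of_le hjq.le
    have h2 : i + 1 + l + 1 - i = l + 2 := by omega
    have h3 : s - j = u := by omega
    rw [h2, h3] at h1
    rw [hs, h2, h3]
    have h4 : i * s + (l + 2) * u < (i + 1 + l) * s + u := by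
      have : 0 < (l + 1) * j := by positivity
      change s = j + u at hu
      rw [hu]
      linarith
    change i * s + _ < _
    omega

variable [CharZero K]

/-- If `g ∘ h` has coefficients in a subfield, where `h` is monic without constant term, then so
does `h`. -/
theorem Polynomial.mem_lifts_of_comp_mem_lifts {g h : L[X]} (hh : h.Monic) (h0 : h.coeff 0 = 0)
    (hg : 0 < g.natDegree) (hgh : g.comp h ∈ lifts (algebraMap K L)) :
    h ∈ lifts (algebraMap K L) := by
  have : CharZero L := charZero_of_injective_algebraMap (algebraMap K L).injective
  let R := (algebraMap K L).fieldRange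
  have hR {p : L[X]} : p ∈ lifts (algebraMap K L) ↔ ∀ i, p.coeff i ∈ R := by
    rw [lifts_iff_coeff_lifts]
    rfl
  set s := h.natDegree with hs
  set r := g.natDegree with hr
  have key : ∀ j < s, h.coeff (s - j) ∈ R := by
    intro j
    induction j using Nat.strong_induction_on with | h j ih =>
    intro hj
    obtain rfl | hj0 := Nat.eq_zero_or_pos j
    · rw [Nat.sub_zero, hh.coeff_natDegree]
      exact one_mem R
    have ha : g.leadingCoeff ∈ R := by
      have := hR.1 hgh (r * s - 0)
      rw [coeff_comp_of_monic hh (by omega), ← hr, Nat.sub_zero, ← hh.natDegree_pow,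
        (hh.pow r).coeff_natDegree, mul_one] at this
      exact this
    have ha0 : g.leadingCoeff ≠ 0 := by
      rw [leadingCoeff_ne_zero]
      rintro h
      simp [hr, h] at hg
    -- `q` is the top part of `h`, already known to have coefficients in `K`; the next coefficient
    -- of `h` enters linearly, with factor `r ≠ 0`.
    let q : L[X] := ∑ i ∈ Finset.Ioc (s - j) s, C (h.coeff i) * X ^ i
    have hqc (i : ℕ) : q.coeff i = if i ∈ Finset.Ioc (s - j) s then h.coeff i else 0 := by
      simp only [q, finsetSum_coeff, coeff_C_mul_X_pow, Finset.sum_ite_eq]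
    have hqd : q.natDegree ≤ s := by
      rw [natDegree_le_iff_coeff_eq_zero]
      intro i hi
      rw [hqc, if_neg (by simp; omega)]
    have hqs : q.coeff s = 1 := by
      rw [hqc, if_pos (by simp; omega), hh.coeff_natDegree]
    have hq : q.Monic := monic_of_natDegree_le_of_coeff_eq_one s hqd hqs
    have hqd' : q.natDegree = s := natDegree_eq_of_le_of_coeff_ne_zero hqd (by simp [hqs])
    have hqR : q ∈ lifts (algebraMap K L) := by
      rw [hR]
      intro i
      rw [hqc]
      split_ifs with hi
      · rw [Finset.mem_Ioc] at hi
        have := ih (s - i) (by omega) (by omega)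
        rwa [Nat.sub_sub_self hi.2] at this
      · exact zero_mem R
    have htd : (h - q).natDegree ≤ q.natDegree - j := by
      rw [natDegree_le_iff_coeff_eq_zero, hqd']
      intro i hi
      rw [coeff_sub, hqc]
      split_ifs with hi'
      · exact sub_self _
      · rw [sub_zero]
        refine coeff_eq_zero_of_natDegree_lt ?_
        simp only [Finset.mem_Ioc] at hi'
        omega
    have h1 := coeff_add_pow_of_monic hq hj0 (by omega) hg htd
    rw [add_sub_cancel, hqd', coeff_sub, hqc, if_neg (by simp), sub_zero] at h1
    have h2 := hR.1 hgh (r * s - j)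
    rw [coeff_comp_of_monic hh hj, ← hr, ← hs, h1] at h2
    have h3 : h.coeff (s - j) = (g.leadingCoeff⁻¹ * (g.leadingCoeff *
        ((q ^ r).coeff (r * s - j) + r * h.coeff (s - j))) - (q ^ r).coeff (r * s - j)) / r := by
      have : (r : L) ≠ 0 := by exact_mod_cast hg.ne'
      field_simp
      ring
    rw [h3]
    exact div_mem (sub_mem (mul_mem (inv_mem ha) h2) (hR.1 (pow_mem hqR r) _)) (natCast_mem R r)
  rw [hR]
  intro i
  obtain rfl | hi := Nat.eq_zero_or_pos i
  · rw [h0]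
    exact zero_mem R
  obtain his | his := le_or_gt i s
  · have := key (s - i) (by omega)
    rwa [Nat.sub_sub_self his] at this
  · rw [coeff_eq_zero_of_natDegree_lt his]
    exact zero_mem R

theorem Polynomial.isIndecomposable_map_of_irreducible_derivative {P : K[X]}
    (hP : 1 < P.natDegree) (hirr : Irreducible (derivative P)) :
    IsIndecomposable (P.map (algebraMap K L)) := by
  refine ⟨by rwa [natDegree_map], ?_⟩
  rintro g h hgh ⟨hg, hh⟩
  have hlc : h.leadingCoeff ≠ 0 := by
    rw [leadingCoeff_ne_zero]
    rintro rfl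
    simp at hh
  let G : L[X] := g.comp (C h.leadingCoeff * X + C (h.coeff 0))
  let H : L[X] := C h.leadingCoeff⁻¹ * (h - C (h.coeff 0))
  have hGH : G.comp H = P.map (algebraMap K L) := by
    rw [hgh, comp_assoc]
    congr 1
    simp only [H, add_comp, mul_comp, C_comp, X_comp]
    rw [← mul_assoc, ← C_mul, mul_inv_cancel₀ hlc, C_1, one_mul, sub_add_cancel]
  have hGd : G.natDegree = g.natDegree := by
    rw [natDegree_comp, natDegree_linear hlc, mul_one]
  have hHd : H.natDegree = h.natDegree := by
    rw [natDegree_C_mul (inv_ne_zero hlc), natDegree_sub_C]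
  have hH : H.Monic := by
    rw [Monic, leadingCoeff, hHd, coeff_C_mul, coeff_sub, coeff_C_of_ne_zero (by omega), sub_zero,
      coeff_natDegree, inv_mul_cancel₀ hlc]
  have hH0 : H.coeff 0 = 0 := by simp [H]
  obtain ⟨H', hH'⟩ := (mem_lifts _).1
    (mem_lifts_of_comp_mem_lifts hH hH0 (by omega) (hGH ▸ (mem_lifts _).2 ⟨P, rfl⟩))
  have hH'd : H'.natDegree = h.natDegree := by rw [← hHd, ← hH', natDegree_map]
  have hPd : P.natDegree = g.natDegree * h.natDegree := by
    rw [← natDegree_map (algebraMap K L), hgh, natDegree_comp]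
  -- Chain rule over `L`; divisibility descends to `K`.
  have hdvd : derivative H' ∣ derivative P := by
    rw [← map_dvd_map' (algebraMap K L), ← derivative_map, ← derivative_map, hH', ← hGH,
      derivative_comp]
    exact dvd_mul_right _ _
  have hlt : h.natDegree < P.natDegree := by
    rw [hPd]
    nlinarith
  obtain ⟨w, hw⟩ := hdvd
  rcases hirr.isUnit_or_isUnit hw with hu | hu
  · have := natDegree_eq_zero_of_isUnit hu
    rw [natDegree_derivative, hH'd] at this
    omega
  · have h1 := congrArg natDegree hw
    have h2 : derivative H' ≠ 0 := by
      rintro h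
      rw [h, zero_mul] at hw
      exact hirr.ne_zero hw
    rw [natDegree_mul h2 hu.ne_zero, natDegree_eq_zero_of_isUnit hu, natDegree_derivative,
      natDegree_derivative, hH'd] at h1
    omega

end Descent

/-! ### Application to the given polynomials -/

theorem isSchurType_derivative {n : ℕ} (hn : 2 ≤ n) (c : ℕ → ℤ) {ε δ : ℤ}
    (hε : ε = 1 ∨ ε = -1) (hδ : δ = 1 ∨ δ = -1) :
    IsSchurType (n - 1) (derivative (C (c 0 : ℚ) + C (ε : ℚ) * X
      + ∑ i ∈ Finset.Ico 2 n, C ((c i : ℚ) / (i ! : ℚ)) * X ^ i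
      + C ((δ : ℚ) / (n ! : ℚ)) * X ^ n)) := by
  obtain ⟨m, rfl⟩ := Nat.exists_eq_add_of_le' (by omega : 1 ≤ n)
  rw [Nat.add_sub_cancel]
  have key (a : ℤ) (i : ℕ) : derivative (C ((a : ℚ) / ((i + 1)! : ℚ)) * X ^ (i + 1)) =
      C ((a : ℚ) / (i ! : ℚ)) * X ^ i := by
    rw [derivative_C_mul_X_pow, Nat.add_sub_cancel]
    congr 2
    rw [factorial_succ]
    push_cast
    field_simp
  refine ⟨by omega, ε, δ, fun i ↦ c (i + 1), hε, hδ, ?_⟩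
  rw [derivative_add, derivative_add, derivative_add, key, derivative_C, zero_add, derivative_sum,
    derivative_C_mul, derivative_X, mul_one, ← Finset.sum_Ico_add' _ 1 m 1]
  simp only [key]

theorem mainTheorem3 (n : ℕ) (hn : 2 ≤ n) (c : ℕ → ℤ) (ε δ : ℤ)
    (hε : ε = 1 ∨ ε = -1) (hδ : δ = 1 ∨ δ = -1) (f : ℚ[X])
    (hf : f = C (c 0 : ℚ) + C (ε : ℚ) * X
      + ∑ i ∈ Finset.Ico 2 n, C ((c i : ℚ) / (i ! : ℚ)) * X ^ i
      + C ((δ : ℚ) / (n ! : ℚ)) * X ^ n) :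
    IsSchurType (n - 1) (derivative f) ∧ Irreducible (derivative f) ∧
      IsIndecomposable (f.map (algebraMap ℚ ℂ)) := by
  have h := isSchurType_derivative hn c hε hδ
  rw [← hf] at h
  have hirr := h.irreducible
  refine ⟨h, hirr, isIndecomposable_map_of_irreducible_derivative ?_ hirr⟩
  have := hirr.natDegree_pos
  rw [natDegree_derivative] at this
  omega
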